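/- Consider untyped $\lambda$-terms (possibly open) up to $\alpha$-equivalence. Distributive reduction $\to_d$ is the closure under arbitrary contexts of the rules $$(\lambda x.x)\,Q\to Q,\qquad (\lambda x.y)\,Q\to y\ \ (y\ne x\text{ a variable}),$$ $$(\lambda x.P_1P_2)\,Q\to((\lambda x.P_1)\,Q)\,((\lambda x.P_2)\,Q),\qquad (\lambda x.\lambda y.P)\,Q\to\lambda y.(\lambda x.P)\,Q\ \ (y\ne x,\ y\text{ not free in }Q).$$ The head spine of a term starts at its root and continues from $\lambda x.M$ into $M$ and from $MN$ into $M$. If $M$ is not in head normal form, the spine redexes of $M$ are the redexes $(\lambda x.P)\,Q$ located on its head spine; the spine redexes of a head normal form $\lambda x_1\ldots\lambda x_n.\,y\,M_1\cdots M_m$ are the spine redexes of $M_1,\dots,M_m$. An inner spine step is a distributive step that contracts an innermost spine redex, i.e. a spine redex $(\lambda x.P)\,Q$ with $P$ in head normal form. (In a head normal form the strategy may work in any of the arguments $M_i$.) **Theorem.** The inner spine strategy is a normalizing strategy for distributive reduction. That is: 1. every inner spine step is a distributive step, and every term from which a distributive step is possible admits an inner spine step; 2. if $M$ has a $\beta$-normal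 form $\hat M$, then there is no infinite sequence of inner spine steps starting from $M$, every sequence of inner spine steps from $M$ that cannot be continued ends in $\hat M$, and $\hat M$ is reached from $M$ by finitely many inner spine steps. -/

import Mathlib

namespace LambdaCalc

/-- Untyped lambda terms up to alpha-equivalence, in de Bruijn notation
(indices start at `0`; open terms are allowed). -/
inductive Term : Type
  | var (n : ℕ) : Term
  | app (M N : Term) : Term
  | lam (M : Term) : Term

namespace Term

/-- Lift a renaming of variables under one binder. -/
def liftRen (f : ℕ → ℕ) : ℕ → ℕ
  | 0 => 0
  | n + 1 => f n + 1

/-- Capture-avoiding renaming of the free variables. -/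
def rename : (ℕ → ℕ) → Term → Term
  | f, var n => var (f n)
  | f, app M N => app (rename f M) (rename f N)
  | f, lam M => lam (rename (liftRen f) M)

/-- Weakening: refer to the same free variables from below one more binder. -/
def shift (M : Term) : Term := rename Nat.succ M

/-- Lift a simultaneous substitution under one binder. -/
def liftSubst (s : ℕ → Term) : ℕ → Term
  | 0 => var 0
  | n + 1 => shift (s n)

/-- Capture-avoiding simultaneous substitution. -/
def subst : (ℕ → Term) → Term → Term
  | s, var n => s n
  | s, app M N => app (subst s M) (subst s N)
  | s, lam M => lam (subst (liftSubst s) M)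

/-- The substitution that replaces the variable `0` by `Q` and removes its binder. -/
def single (Q : Term) : ℕ → Term
  | 0 => Q
  | n + 1 => var n

/-- `P.inst Q` is the contractum `P[x := Q]` of the redex `(λx. P) Q`. -/
def inst (P Q : Term) : Term := subst (single Q) P

end Term

open Term

/-- The beta rule `(λx. P) Q → P[x := Q]`. -/
inductive BetaRule : Term → Term → Prop
  | beta (P Q : Term) : BetaRule (app (lam P) Q) (P.inst Q)

/-- The rules of distributive reduction:
`(λx. x) Q → Q`; `(λx. y) Q → y` for a variable `y ≠ x`;
`(λx. P₁ P₂) Q → ((λx. P₁) Q) ((λx. P₂) Q)`; and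
`(λx. λy. P) Q → λy. (λx. P) Q` for `y ≠ x` not free in `Q`.
In the last rule the two innermost binders change places, so that the de Bruijn indices `0` and
`1` of `P` are exchanged. -/
inductive DistRule : Term → Term → Prop
  | same (Q : Term) : DistRule (app (lam (var 0)) Q) Q
  | other (n : ℕ) (Q : Term) : DistRule (app (lam (var (n + 1))) Q) (var n)
  | app (P₁ P₂ Q : Term) :
      DistRule (app (lam (app P₁ P₂)) Q) (app (app (lam P₁) Q) (app (lam P₂) Q))
  | lam (P Q : Term) :
      DistRule (app (lam (lam P)) Q)
        (lam (app (lam (P.rename (Equiv.swap 0 1))) Q.shift))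

/-- The one-step relation generated by a rule: contraction in an arbitrary context. -/
inductive Compatible (r : Term → Term → Prop) : Term → Term → Prop
  | root {M N : Term} : r M N → Compatible r M N
  | lam {M N : Term} : Compatible r M N → Compatible r (lam M) (lam N)
  | appL {M N : Term} (Q : Term) : Compatible r M N → Compatible r (app M Q) (app N Q)
  | appR {M N : Term} (P : Term) : Compatible r M N → Compatible r (app P M) (app P N)

/-- One-step beta reduction. -/
def BetaStep : Term → Term → Prop := Compatible BetaRule

/-- One-step distributive reduction. -/
def DistStep : Term → Term → Prop := Compatible DistRule

/-- `M` is normal for `r`: no `r`-step starts from `M`. -/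
def IsNormal (r : Term → Term → Prop) (M : Term) : Prop := ∀ N, ¬ r M N

/-- Terms of the form `y M₁ … Mₘ` with a variable `y` and `m ≥ 0`. -/
inductive IsNeutral : Term → Prop
  | var (n : ℕ) : IsNeutral (var n)
  | app {M : Term} (N : Term) : IsNeutral M → IsNeutral (app M N)

/-- Head normal forms `λx₁ … λxₙ. y M₁ … Mₘ` with `n, m ≥ 0`. -/
inductive IsHnf : Term → Prop
  | neutral {M : Term} : IsNeutral M → IsHnf M
  | lam {M : Term} : IsHnf M → IsHnf (lam M)

/-- Apply `r` at a position of the head spine, which starts at the root and continues from `λx. M`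
into `M` and from `M Q` into `M`. -/
inductive HeadSpine (r : Term → Term → Prop) : Term → Term → Prop
  | root {M N : Term} : r M N → HeadSpine r M N
  | lam {M N : Term} : HeadSpine r M N → HeadSpine r (lam M) (lam N)
  | app {M N : Term} (Q : Term) : HeadSpine r M N → HeadSpine r (app M Q) (app N Q)

/-- Apply `r`, a rule that rewrites only redexes `(λx. P) Q`, at a spine position. A term that is
not in head normal form has its head spine redexes as spine redexes; the spine redexes of
`λx₁ … λxₙ. y M₁ … Mₘ` are those of `M₁, …, Mₘ`. -/
inductive Spine (r : Term → Term → Prop) : Term → Term → Prop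
  | head {M N : Term} : HeadSpine r M N → Spine r M N
  | lam {M N : Term} : Spine r M N → Spine r (lam M) (lam N)
  | appL {M N : Term} (Q : Term) : IsNeutral M → Spine r M N → Spine r (app M Q) (app N Q)
  | appR {M N : Term} (P : Term) : IsNeutral P → Spine r M N → Spine r (app P M) (app P N)

/-- A distributive contraction of `(λx. P) Q` in which `P` is in head normal form, that is, in which
there is no further redex on the head spine of `P`. -/
inductive InnerDistRule : Term → Term → Prop
  | intro {P Q N : Term} : IsHnf P → DistRule (app (lam P) Q) N →
      InnerDistRule (app (lam P) Q) N

/-- The inner spine strategy: a distributive step that contracts an innermost spine redex. The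
strategy is free in the choice of the argument of a head normal form in which it works. -/
def InnerSpineStep : Term → Term → Prop := Spine InnerDistRule

/-- `s` is a strategy for `r`: each `s`-step is an `r`-step, and `s` stops at `r`-normal forms
only. -/
def IsStrategyFor (s r : Term → Term → Prop) : Prop :=
  (∀ M N, s M N → r M N) ∧ ∀ M, IsNormal s M → IsNormal r M

/-- `s` is normalizing: from a term `M` with beta normal form `L`, there is no infinite `s`-reduction,
each `s`-reduction that cannot be continued ends in `L`, and `s` reaches `L`. -/
def IsNormalizing (s : Term → Term → Prop) : Prop :=
  ∀ M L : Term, Relation.ReflTransGen BetaStep M L → IsNormal BetaStep L →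
    (¬ ∃ f : ℕ → Term, f 0 = M ∧ ∀ i, s (f i) (f (i + 1))) ∧
    (∀ N, Relation.ReflTransGen s M N → IsNormal s N → N = L) ∧
    Relation.ReflTransGen s M L

end LambdaCalc

/-!
Inner spine reduction is compared with *spine beta reduction*, the contraction of arbitrary spine
redexes, by means of parallel beta reduction `M ⇒ N`. Think of the redexes contracted in `M ⇒ N` as
pending substitutions of `M`; then `N` is `M` with its pending substitutions carried out.

An inner spine step `M → M'` contracts a redex `(λx. P) Q` with `P` in head normal form.
* If the redex is pending in `M ⇒ N`, the step moves a substitution one level down, so that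
  `M' ⇒ N` still holds. Since `P` is in head normal form, a pending substitution is never moved
  across another one, and such steps are bounded by the polynomial measure
  `|(λx. P) Q| = |P| (|Q| + 1)` recorded in `ParSize`.
* Otherwise the redex leaves a redex on the spine of `N`; let `N'` be the result of contracting it.
  The parts into which the step distributes the redex become pending, and `M' ⇒ N'`.

This is `ParSize.innerSpineStep`. So inner spine reduction terminates from `M` as soon as spine beta
reduction does (`acc_innerSpineStep`), and a normal form that it reaches is also reached by spine
beta reduction, since `M ⇒ N` implies `M = N` for normal `M`.

That spine beta reduction terminates from every term `M` with a beta normal form `L`, and only in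
`L`, follows by induction on the length of a reduction from `M` to `L`, with a similar diagram: if
`M ⇒ N` and `M → M'` is a spine beta step, then either `N → N'` by a spine step and `M' ⇒ N'`, or
the contracted redex is one of those of `M ⇒ N`, and then `M' ⇒ N` with one contraction less
(`ParCost.spine`). The reason is that spine redexes are never duplicated. The number of contractions
is recorded in `ParCost`; it counts the contractions in `Q` once for every occurrence of `x`
in the reduct of `P` when `(λx. P) Q` is contracted.
-/

namespace LambdaCalc

open Term

/-! ### Renaming and substitution -/

namespace Term

theorem liftRen_comp (f g : ℕ → ℕ) : liftRen f ∘ liftRen g = liftRen (f ∘ g) := by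
  funext i; cases i <;> rfl

theorem rename_rename (f g : ℕ → ℕ) (M : Term) : rename f (rename g M) = rename (f ∘ g) M := by
  induction M generalizing f g with
  | var n => rfl
  | app M N ihM ihN => simp [rename, ihM, ihN]
  | lam M ih => simp [rename, ih, liftRen_comp]

theorem liftSubst_comp_liftRen (s : ℕ → Term) (f : ℕ → ℕ) :
    liftSubst s ∘ liftRen f = liftSubst (s ∘ f) := by
  funext i; cases i <;> rfl

theorem subst_rename (s : ℕ → Term) (f : ℕ → ℕ) (M : Term) :
    subst s (rename f M) = subst (s ∘ f) M := by
  induction M generalizing f s with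
  | var n => rfl
  | app M N ihM ihN => simp [rename, subst, ihM, ihN]
  | lam M ih => simp [rename, subst, ih, liftSubst_comp_liftRen]

theorem rename_comp_liftSubst (f : ℕ → ℕ) (s : ℕ → Term) :
    rename (liftRen f) ∘ liftSubst s = liftSubst (rename f ∘ s) := by
  funext i
  cases i with
  | zero => rfl
  | succ i => simp only [Function.comp, liftSubst, shift, rename_rename]; rfl

theorem rename_subst (f : ℕ → ℕ) (s : ℕ → Term) (M : Term) :
    rename f (subst s M) = subst (rename f ∘ s) M := by
  induction M generalizing f s with
  | var n => rfl
  | app M N ihM ihN => simp [rename, subst, ihM, ihN]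
  | lam M ih => simp [rename, subst, ih, rename_comp_liftSubst]

theorem subst_comp_liftSubst (s t : ℕ → Term) :
    subst (liftSubst s) ∘ liftSubst t = liftSubst (subst s ∘ t) := by
  funext i
  cases i with
  | zero => rfl
  | succ i => simp only [Function.comp, liftSubst, shift, subst_rename, rename_subst]; rfl

theorem subst_subst (s t : ℕ → Term) (M : Term) :
    subst s (subst t M) = subst (subst s ∘ t) M := by
  induction M generalizing s t with
  | var n => rfl
  | app M N ihM ihN => simp [subst, ihM, ihN]
  | lam M ih => simp [subst, ih, subst_comp_liftSubst]

theorem liftSubst_var : liftSubst var = var := by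
  funext i; cases i <;> rfl

theorem subst_var (M : Term) : subst var M = M := by
  induction M with
  | var n => rfl
  | app M N ihM ihN => simp [subst, ihM, ihN]
  | lam M ih => simp [subst, liftSubst_var, ih]

theorem inst_shift (M Q : Term) : inst (shift M) Q = M := by
  rw [inst, shift, subst_rename]; exact subst_var M

theorem rename_inst (f : ℕ → ℕ) (P Q : Term) :
    rename f (P.inst Q) = (rename (liftRen f) P).inst (rename f Q) := by
  rw [inst, inst, rename_subst, subst_rename]
  congr 1
  funext i; cases i <;> rfl

theorem subst_inst (s : ℕ → Term) (P Q : Term) :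
    subst s (P.inst Q) = (subst (liftSubst s) P).inst (subst s Q) := by
  rw [inst, inst, subst_subst, subst_subst]
  congr 1
  funext i
  cases i with
  | zero => rfl
  | succ i => exact (inst_shift (s i) (subst s Q)).symm

/-- Substitution under a binder agrees with the exchange of binders in the last rule of
distributive reduction. -/
theorem inst_swap_shift (P Q : Term) :
    (P.rename (Equiv.swap 0 1)).inst Q.shift = subst (liftSubst (single Q)) P := by
  rw [inst, subst_rename]
  congr 1
  funext i
  match i with
  | 0 => simp [single, liftSubst]
  | 1 => simp [single, liftSubst]
  | i + 2 =>
    have h : Equiv.swap 0 1 (i + 2) = i + 2 := Equiv.swap_apply_of_ne_of_ne (by simp) (by simp)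
    simp only [Function.comp, h]; rfl

end Term

/-! ### Redexes on the spine -/

theorem IsNeutral.ne_lam {M P : Term} (h : IsNeutral M) : M ≠ lam P := by
  rintro rfl; cases h

theorem IsHnf.of_lam {M : Term} (h : IsHnf (Term.lam M)) : IsHnf M := by
  cases h with
  | neutral h => cases h
  | lam h => exact h

theorem IsHnf.isNeutral_left {M N : Term} (h : IsHnf (app M N)) : IsNeutral M := by
  cases h with
  | neutral h => cases h; assumption

theorem HeadSpine.compatible {r r' : Term → Term → Prop} (hr : ∀ M N, r M N → r' M N)
    {M N : Term} (h : HeadSpine r M N) : Compatible r' M N := by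
  induction h with
  | root h => exact .root (hr _ _ h)
  | lam _ ih => exact .lam ih
  | app Q _ ih => exact .appL Q ih

theorem Spine.compatible {r r' : Term → Term → Prop} (hr : ∀ M N, r M N → r' M N)
    {M N : Term} (h : Spine r M N) : Compatible r' M N := by
  induction h with
  | head h => exact h.compatible hr
  | lam _ ih => exact .lam ih
  | appL Q _ _ ih => exact .appL Q ih
  | appR P _ _ ih => exact .appR P ih

/-- Every redex can be contracted distributively, by a case distinction on its body. -/
theorem exists_distRule (P Q : Term) : ∃ N, DistRule (app (lam P) Q) N := by
  match P with
  | var 0 => exact ⟨_, .same Q⟩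
  | var (n + 1) => exact ⟨_, .other n Q⟩
  | app P₁ P₂ => exact ⟨_, .app P₁ P₂ Q⟩
  | lam P => exact ⟨_, .lam P Q⟩

/-- The last redex on the head spine of a term is an inner one. -/
theorem exists_headSpine_of_not_isHnf {M : Term} (h : ¬ IsHnf M) :
    ∃ N, HeadSpine InnerDistRule M N := by
  induction M with
  | var n => exact absurd (.neutral (.var n)) h
  | lam M ih =>
    obtain ⟨N, hN⟩ := ih fun hM => h (.lam hM)
    exact ⟨_, .lam hN⟩
  | app M Q ih _ =>
    by_cases hM : IsHnf M
    · cases hM with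
      | neutral hM => exact absurd (.neutral (.app Q hM)) h
      | @lam P hP =>
        obtain ⟨N, hN⟩ := exists_distRule P Q
        exact ⟨N, .root (.intro hP hN)⟩
    · obtain ⟨N, hN⟩ := ih hM
      exact ⟨_, .app Q hN⟩

/-- A term without inner spine steps contains no redex. -/
theorem isNormal_compatible_of_innerSpineStep {r : Term → Term → Prop}
    (hr : ∀ M N, r M N → ∃ P Q, M = app (lam P) Q) {M : Term}
    (h : IsNormal InnerSpineStep M) : IsNormal (Compatible r) M := by
  induction M with
  | var n =>
    rintro N (hN | _)
    obtain ⟨P, Q, e⟩ := hr _ _ hN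
    cases e
  | lam M ih =>
    rintro N (hN | hN)
    · obtain ⟨P, Q, e⟩ := hr _ _ hN
      cases e
    · exact ih (fun N hN => h _ (.lam hN)) _ hN
  | app M Q ihM ihQ =>
    have hM : IsNeutral M := by
      by_contra hM
      obtain ⟨N, hN⟩ := exists_headSpine_of_not_isHnf fun hMQ => hM (IsHnf.isNeutral_left hMQ)
      exact h N (.head hN)
    intro N hN
    cases hN with
    | root hN =>
      obtain ⟨P, Q, e⟩ := hr _ _ hN
      cases e
      cases hM
    | appL _ hN => exact ihM (fun N hN => h _ (.appL Q hM hN)) _ hN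
    | appR _ hN => exact ihQ (fun N hN => h _ (.appR M hM hN)) _ hN

theorem DistRule.exists_redex {M N : Term} (h : DistRule M N) :
    ∃ P Q, M = Term.app (Term.lam P) Q := by
  cases h <;> exact ⟨_, _, rfl⟩

theorem BetaRule.exists_redex {M N : Term} (h : BetaRule M N) : ∃ P Q, M = app (lam P) Q := by
  cases h; exact ⟨_, _, rfl⟩

theorem InnerDistRule.exists_redex {M N : Term} (h : InnerDistRule M N) :
    ∃ P Q, M = app (lam P) Q := by
  cases h; exact ⟨_, _, rfl⟩

theorem isStrategyFor_innerSpineStep : IsStrategyFor InnerSpineStep DistStep :=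
  ⟨fun _ _ h => Spine.compatible (fun _ _ h => by cases h; assumption) h,
    fun _ h => isNormal_compatible_of_innerSpineStep (fun _ _ => DistRule.exists_redex) h⟩

theorem HeadSpine.exists_of_lam {r : Term → Term → Prop}
    (hr : ∀ M N, r M N → ∃ P Q, M = Term.app (Term.lam P) Q) {M N : Term}
    (h : HeadSpine r (Term.lam M) N) : ∃ M', N = Term.lam M' ∧ HeadSpine r M M' := by
  cases h with
  | root h =>
    obtain ⟨P, Q, e⟩ := hr _ _ h
    cases e
  | lam h => exact ⟨_, rfl, h⟩

/-- Substitution preserves head spine steps: it neither moves nor copies the head spine. -/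
theorem HeadSpine.subst {M N : Term} (h : HeadSpine BetaRule M N) (s : ℕ → Term) :
    HeadSpine BetaRule (M.subst s) (N.subst s) := by
  induction h generalizing s with
  | root h =>
    cases h with
    | beta P Q => rw [subst_inst]; exact .root (.beta _ _)
  | lam _ ih => exact .lam (ih _)
  | app Q _ ih => exact .app _ (ih s)

/-! ### Parallel reduction with the number of its contractions -/

/-- The assignment `w` of weights to variables, extended by the weight `a` of a new variable `0`. -/
def consWeight (a : ℕ) (w : ℕ → ℕ) : ℕ → ℕ
  | 0 => a
  | n + 1 => w n

/-- `ParCost w n M N`: there is a parallel beta reduction from `M` to `N` of cost `n`, where an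
occurrence of the variable `i` costs `w i` and a contraction costs `1`. In a contracted redex
`(λx. P) Q` an occurrence of `x` in `P` costs as much as the reduction of `Q`, so that the cost for
`w = 0` is the number of steps that carry out the contractions one by one, outermost first. -/
inductive ParCost : (ℕ → ℕ) → ℕ → Term → Term → Prop
  | var (w : ℕ → ℕ) (i : ℕ) : ParCost w (w i) (var i) (var i)
  | lam {w : ℕ → ℕ} {n : ℕ} {M M' : Term} :
      ParCost (consWeight 0 w) n M M' → ParCost w n (lam M) (lam M')
  | app {w : ℕ → ℕ} {m n : ℕ} {M M' N N' : Term} :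
      ParCost w m M M' → ParCost w n N N' → ParCost w (m + n) (app M N) (app M' N')
  | beta {w : ℕ → ℕ} {p q : ℕ} {P P' Q Q' : Term} :
      ParCost (consWeight q w) p P P' → ParCost w q Q Q' →
      ParCost w (p + 1) (app (lam P) Q) (P'.inst Q')

namespace ParCost

theorem exists_refl (w : ℕ → ℕ) (M : Term) : ∃ n, ParCost w n M M := by
  induction M generalizing w with
  | var i => exact ⟨_, .var w i⟩
  | lam M ih => exact (ih _).imp fun _ h => h.lam
  | app M N ihM ihN =>
    obtain ⟨m, hm⟩ := ihM w
    obtain ⟨n, hn⟩ := ihN w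
    exact ⟨_, hm.app hn⟩

theorem exists_of_betaStep (w : ℕ → ℕ) {M N : Term} (h : BetaStep M N) :
    ∃ n, ParCost w n M N := by
  induction h generalizing w with
  | root h =>
    cases h with
    | beta P Q =>
      obtain ⟨q, hq⟩ := exists_refl w Q
      obtain ⟨p, hp⟩ := exists_refl (consWeight q w) P
      exact ⟨_, hp.beta hq⟩
  | lam _ ih => exact (ih _).imp fun _ h => h.lam
  | appL Q _ ih =>
    obtain ⟨m, hm⟩ := ih w
    obtain ⟨n, hn⟩ := exists_refl w Q
    exact ⟨_, hm.app hn⟩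
  | appR P _ ih =>
    obtain ⟨m, hm⟩ := exists_refl w P
    obtain ⟨n, hn⟩ := ih w
    exact ⟨_, hm.app hn⟩

theorem exists_cost {w : ℕ → ℕ} {n : ℕ} {M N : Term} (h : ParCost w n M N) (w' : ℕ → ℕ) :
    ∃ n', ParCost w' n' M N := by
  induction h generalizing w' with
  | var w i => exact ⟨_, .var w' i⟩
  | lam _ ih => exact (ih _).imp fun _ h => h.lam
  | app _ _ ihM ihN =>
    obtain ⟨m, hm⟩ := ihM w'
    obtain ⟨n, hn⟩ := ihN w'
    exact ⟨_, hm.app hn⟩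
  | beta _ _ ihP ihQ =>
    obtain ⟨q, hq⟩ := ihQ w'
    obtain ⟨p, hp⟩ := ihP (consWeight q w')
    exact ⟨_, hp.beta hq⟩

theorem consWeight_liftRen {w w' : ℕ → ℕ} {f : ℕ → ℕ} (hw : ∀ i, w' (f i) = w i) (a i : ℕ) :
    consWeight a w' (liftRen f i) = consWeight a w i := by
  cases i with
  | zero => rfl
  | succ i => exact hw i

theorem rename {w : ℕ → ℕ} {n : ℕ} {M N : Term} (h : ParCost w n M N) {w' : ℕ → ℕ} {f : ℕ → ℕ}
    (hw : ∀ i, w' (f i) = w i) : ParCost w' n (M.rename f) (N.rename f) := by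
  induction h generalizing w' f with
  | var w i => rw [← hw i]; exact .var w' (f i)
  | lam _ ih => exact .lam (ih (consWeight_liftRen hw 0))
  | app _ _ ihM ihN => exact .app (ihM hw) (ihN hw)
  | beta _ _ ihP ihQ => rw [rename_inst]; exact .beta (ihP (consWeight_liftRen hw _)) (ihQ hw)

theorem liftSubst {w w' : ℕ → ℕ} {s s' : ℕ → Term} (hs : ∀ i, ParCost w' (w i) (s i) (s' i))
    (a i : ℕ) : ParCost (consWeight a w') (consWeight a w i) (Term.liftSubst s i)
      (Term.liftSubst s' i) := by
  cases i with
  | zero => exact .var (consWeight a w') 0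
  | succ i => exact (hs i).rename fun _ => rfl

/-- Substituting for each variable a reduction whose cost is the weight of that variable does not
change the cost. -/
theorem subst {w : ℕ → ℕ} {n : ℕ} {M N : Term} (h : ParCost w n M N) {w' : ℕ → ℕ}
    {s s' : ℕ → Term} (hs : ∀ i, ParCost w' (w i) (s i) (s' i)) :
    ParCost w' n (M.subst s) (N.subst s') := by
  induction h generalizing w' s s' with
  | var w i => exact hs i
  | lam _ ih => exact .lam (ih (liftSubst hs 0))
  | app _ _ ihM ihN => exact .app (ihM hs) (ihN hs)
  | beta _ _ ihP ihQ => rw [subst_inst]; exact .beta (ihP (liftSubst hs _)) (ihQ hs)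

theorem inst {w : ℕ → ℕ} {p q : ℕ} {P P' Q Q' : Term} (hP : ParCost (consWeight q w) p P P')
    (hQ : ParCost w q Q Q') : ParCost w p (P.inst Q) (P'.inst Q') := by
  refine hP.subst fun i => ?_
  cases i with
  | zero => exact hQ
  | succ i => exact .var w i

theorem headSpine {w : ℕ → ℕ} {n : ℕ} {M M' N : Term} (h : ParCost w n M N)
    (hM : HeadSpine BetaRule M M') :
    (∃ k, k < n ∧ ParCost w k M' N) ∨ ∃ k N', HeadSpine BetaRule N N' ∧ ParCost w k M' N' := by
  induction h generalizing M' with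
  | var w i => cases hM with | root hM => cases hM
  | lam _ ih =>
    obtain ⟨M'', rfl, hM'⟩ := hM.exists_of_lam fun _ _ => BetaRule.exists_redex
    obtain ⟨k, hk, h⟩ | ⟨k, N', hN, h⟩ := ih hM'
    · exact .inl ⟨k, hk, h.lam⟩
    · exact .inr ⟨k, _, .lam hN, h.lam⟩
  | app hP hQ ihP ihQ =>
    cases hM with
    | root hM =>
      cases hM with
      | beta P Q =>
        cases hP with
        | lam hP =>
          obtain ⟨p, hp⟩ := hP.exists_cost (consWeight _ _)
          exact .inr ⟨p, _, .root (.beta _ _), hp.inst hQ⟩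
    | app _ hM =>
      obtain ⟨k, hk, h⟩ | ⟨k, N', hN, h⟩ := ihP hM
      · exact .inl ⟨_, Nat.add_lt_add_right hk _, h.app hQ⟩
      · exact .inr ⟨_, _, .app _ hN, h.app hQ⟩
  | beta hP hQ ihP ihQ =>
    cases hM with
    | root hM =>
      cases hM with
      | beta P Q => exact .inl ⟨_, Nat.lt_succ_self _, hP.inst hQ⟩
    | app _ hM =>
      obtain ⟨M'', rfl, hM'⟩ := hM.exists_of_lam fun _ _ => BetaRule.exists_redex
      obtain ⟨k, hk, h⟩ | ⟨k, N', hN, h⟩ := ihP hM'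
      · exact .inl ⟨_, Nat.add_lt_add_right hk 1, h.beta hQ⟩
      · exact .inr ⟨_, _, hN.subst _, h.beta hQ⟩

theorem isNeutral {w : ℕ → ℕ} {n : ℕ} {M N : Term} (h : ParCost w n M N) (hM : IsNeutral M) :
    IsNeutral N := by
  induction h with
  | var w i => exact hM
  | lam _ _ => cases hM
  | app _ _ ihM _ => cases hM with | app _ hM => exact .app _ (ihM hM)
  | beta _ _ _ _ => cases hM with | app _ hM => cases hM

/-- A spine step from the source of a parallel reduction either contracts one of the redexes of the
parallel reduction, or persists as a single spine step from the target. -/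
theorem spine {w : ℕ → ℕ} {n : ℕ} {M M' N : Term} (h : ParCost w n M N)
    (hM : Spine BetaRule M M') :
    (∃ k, k < n ∧ ParCost w k M' N) ∨ ∃ k N', Spine BetaRule N N' ∧ ParCost w k M' N' := by
  induction hM generalizing w n N with
  | head hM => exact (h.headSpine hM).imp id fun ⟨k, N', hN, h⟩ => ⟨k, N', .head hN, h⟩
  | lam _ ih =>
    cases h with
    | lam h =>
      obtain ⟨k, hk, h⟩ | ⟨k, N', hN, h⟩ := ih h
      · exact .inl ⟨k, hk, h.lam⟩
      · exact .inr ⟨k, _, .lam hN, h.lam⟩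
  | appL Q hneu _ ih =>
    cases h with
    | app h hQ =>
      obtain ⟨k, hk, h'⟩ | ⟨k, N', hN, h'⟩ := ih h
      · exact .inl ⟨_, Nat.add_lt_add_right hk _, h'.app hQ⟩
      · exact .inr ⟨_, _, .appL _ (h.isNeutral hneu) hN, h'.app hQ⟩
    | beta => cases hneu
  | appR P hneu _ ih =>
    cases h with
    | app hP h =>
      obtain ⟨k, hk, h'⟩ | ⟨k, N', hN, h'⟩ := ih h
      · exact .inl ⟨_, Nat.add_lt_add_left hk _, hP.app h'⟩
      · exact .inr ⟨_, _, .appR _ (hP.isNeutral hneu) hN, hP.app h'⟩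
    | beta => cases hneu

theorem eq_of_isNormal {w : ℕ → ℕ} {n : ℕ} {M N : Term} (h : ParCost w n M N)
    (hM : IsNormal BetaStep M) : N = M := by
  induction h with
  | var w i => rfl
  | lam _ ih => rw [ih fun N hN => hM _ (.lam hN)]
  | app _ _ ihM ihN =>
    rw [ihM fun N hN => hM _ (.appL _ hN), ihN fun N hN => hM _ (.appR _ hN)]
  | beta _ _ _ _ => exact absurd (.root (.beta _ _)) (hM _)

/-- Termination of spine reduction is inherited along a parallel reduction from its target to its
source, by lexicographic induction on spine reduction of the target and on the cost. -/
theorem acc_spine {w : ℕ → ℕ} {n : ℕ} {M N : Term} (h : ParCost w n M N)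
    (hN : Acc (flip (Spine BetaRule)) N) : Acc (flip (Spine BetaRule)) M := by
  induction hN generalizing n M with
  | intro N _ ih =>
    induction n using Nat.strong_induction_on generalizing M with
    | _ n ihn =>
      refine ⟨_, fun M' hM => ?_⟩
      obtain ⟨k, hk, h'⟩ | ⟨k, N', hN, h'⟩ := h.spine hM
      · exact ihn k hk h'
      · exact ih N' hN h'

theorem spine_reflTransGen {w : ℕ → ℕ} {n : ℕ} {M M' N : Term} (h : ParCost w n M N)
    (hM : Relation.ReflTransGen (Spine BetaRule) M M') :
    ∃ k N', Relation.ReflTransGen (Spine BetaRule) N N' ∧ ParCost w k M' N' := by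
  induction hM with
  | refl => exact ⟨n, N, .refl, h⟩
  | tail _ hM ih =>
    obtain ⟨m, N₁, hN₁, h₁⟩ := ih
    obtain ⟨k, _, h₂⟩ | ⟨k, N₂, hN₂, h₂⟩ := h₁.spine hM
    · exact ⟨k, N₁, hN₁, h₂⟩
    · exact ⟨k, N₂, hN₁.tail hN₂, h₂⟩

end ParCost

/-! ### Spine beta reduction is normalizing -/

theorem IsNormal.not_spine {M N : Term} (h : IsNormal BetaStep M) : ¬ Spine BetaRule M N :=
  fun hM => h N (hM.compatible fun _ _ => id)

theorem acc_spine_of_reflTransGen {M L : Term} (h : Relation.ReflTransGen BetaStep M L)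
    (hL : IsNormal BetaStep L) : Acc (flip (Spine BetaRule)) M := by
  induction h using Relation.ReflTransGen.head_induction_on with
  | refl => exact ⟨_, fun N hN => absurd hN hL.not_spine⟩
  | head h _ ih =>
    obtain ⟨n, hn⟩ := ParCost.exists_of_betaStep 0 h
    exact hn.acc_spine ih

theorem eq_of_spine_reflTransGen {M N L : Term} (h : Relation.ReflTransGen BetaStep M L)
    (hL : IsNormal BetaStep L) (hM : Relation.ReflTransGen (Spine BetaRule) M N)
    (hN : IsNormal BetaStep N) : N = L := by
  induction h using Relation.ReflTransGen.head_induction_on generalizing N with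
  | refl =>
    obtain rfl | ⟨N', hN', _⟩ := hM.cases_head
    · rfl
    · exact absurd hN' hL.not_spine
  | head h _ ih =>
    obtain ⟨n, hn⟩ := ParCost.exists_of_betaStep 0 h
    obtain ⟨k, N', hN', hk⟩ := hn.spine_reflTransGen hM
    obtain rfl := hk.eq_of_isNormal hN
    exact ih hN' hN

/-! ### Parallel reduction with a measure of its pending substitutions -/

/-- `ParSize k M N`: there is a parallel beta reduction from `M` to `N` for which `M` has size `k`.
The size of a contracted redex `(λx. P) Q` is that of `P` multiplied by one more than that of `Q`,
which makes it drop when the redex is distributed over `P`. -/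
inductive ParSize : ℕ → Term → Term → Prop
  | var (i : ℕ) : ParSize 1 (var i) (var i)
  | lam {m : ℕ} {M M' : Term} : ParSize m M M' → ParSize (m + 1) (lam M) (lam M')
  | app {m n : ℕ} {M M' N N' : Term} :
      ParSize m M M' → ParSize n N N' → ParSize (m + n + 1) (app M N) (app M' N')
  | beta {p q : ℕ} {P P' Q Q' : Term} :
      ParSize p P P' → ParSize q Q Q' →
      ParSize (p * (q + 1)) (app (lam P) Q) (P'.inst Q')

namespace ParSize

theorem pos {k : ℕ} {M N : Term} (h : ParSize k M N) : 0 < k := by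
  induction h with
  | beta _ _ ihP _ => positivity
  | _ => omega

theorem exists_refl (M : Term) : ∃ k, ParSize k M M := by
  induction M with
  | var i => exact ⟨_, .var i⟩
  | lam M ih => exact ih.elim fun _ h => ⟨_, h.lam⟩
  | app M N ihM ihN =>
    obtain ⟨m, hm⟩ := ihM
    obtain ⟨n, hn⟩ := ihN
    exact ⟨_, hm.app hn⟩

theorem rename {k : ℕ} {M N : Term} (h : ParSize k M N) (f : ℕ → ℕ) :
    ParSize k (M.rename f) (N.rename f) := by
  induction h generalizing f with
  | var i => exact .var (f i)
  | lam _ ih => exact .lam (ih _)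
  | app _ _ ihM ihN => exact .app (ihM f) (ihN f)
  | beta _ _ ihP ihQ => rw [rename_inst]; exact .beta (ihP _) (ihQ f)

theorem isNeutral {k : ℕ} {M N : Term} (h : ParSize k M N) (hM : IsNeutral M) : IsNeutral N := by
  induction h with
  | var i => exact hM
  | lam _ _ => cases hM
  | app _ _ ihM _ => cases hM with | app _ hM => exact .app _ (ihM hM)
  | beta _ _ _ _ => cases hM with | app _ hM => cases hM

/-- A distributive step at a redex with body in head normal form makes the substitutions that it
creates pending, and their size is smaller than that of the pending redex. -/
theorem distRule {p q : ℕ} {P P' Q Q' N : Term} (hP : ParSize p P P') (hQ : ParSize q Q Q')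
    (hnf : IsHnf P) (hN : DistRule (Term.app (Term.lam P) Q) N) :
    ∃ k, k < p * (q + 1) ∧ ParSize k N (P'.inst Q') := by
  have hq := hQ.pos
  cases hN with
  | same => cases hP; exact ⟨q, by omega, hQ⟩
  | other n => cases hP; exact ⟨1, by omega, .var n⟩
  | app P₁ P₂ =>
    cases hP with
    | app h₁ h₂ => exact ⟨_, by nlinarith, (h₁.beta hQ).app (h₂.beta hQ)⟩
    -- This is where innermost redexes matter: `P₁ P₂` is not itself a pending redex.
    | beta => exact absurd rfl hnf.isNeutral_left.ne_lam
  | lam P =>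
    cases hP with
    | lam h =>
      have h' := ((h.rename (Equiv.swap 0 1)).beta (hQ.rename Nat.succ)).lam
      rw [show Term.rename Nat.succ Q' = Q'.shift from rfl, inst_swap_shift] at h'
      exact ⟨_, by nlinarith, h'⟩

theorem headSpine {k : ℕ} {M M' N : Term} (h : ParSize k M N)
    (hM : HeadSpine InnerDistRule M M') :
    (∃ l, l < k ∧ ParSize l M' N) ∨ ∃ l N', HeadSpine BetaRule N N' ∧ ParSize l M' N' := by
  induction h generalizing M' with
  | var i => cases hM with | root hM => cases hM
  | lam _ ih =>
    obtain ⟨M'', rfl, hM'⟩ := hM.exists_of_lam fun _ _ => InnerDistRule.exists_redex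
    obtain ⟨l, hl, h⟩ | ⟨l, N', hN, h⟩ := ih hM'
    · exact .inl ⟨_, Nat.add_lt_add_right hl 1, h.lam⟩
    · exact .inr ⟨_, _, .lam hN, h.lam⟩
  | app hP hQ ihP ihQ =>
    cases hM with
    | root hM =>
      cases hM with
      | intro hnf hM =>
        cases hP with
        | lam hP =>
          obtain ⟨l, _, h⟩ := hP.distRule hQ hnf hM
          exact .inr ⟨l, _, .root (.beta _ _), h⟩
    | app _ hM =>
      obtain ⟨l, hl, h⟩ | ⟨l, N', hN, h⟩ := ihP hM
      · exact .inl ⟨_, by omega, h.app hQ⟩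
      · exact .inr ⟨_, _, .app _ hN, h.app hQ⟩
  | beta hP hQ ihP ihQ =>
    cases hM with
    | root hM =>
      cases hM with
      | intro hnf hM => exact .inl (hP.distRule hQ hnf hM)
    | app _ hM =>
      obtain ⟨M'', rfl, hM'⟩ := hM.exists_of_lam fun _ _ => InnerDistRule.exists_redex
      obtain ⟨l, hl, h⟩ | ⟨l, N', hN, h⟩ := ihP hM'
      · exact .inl ⟨_, Nat.mul_lt_mul_of_pos_right hl (Nat.succ_pos _), h.beta hQ⟩
      · exact .inr ⟨_, _, hN.subst _, h.beta hQ⟩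

/-- An inner spine step either moves a pending substitution, or persists as a spine beta step after
the pending substitutions have been carried out. -/
theorem innerSpineStep {k : ℕ} {M M' N : Term} (h : ParSize k M N) (hM : InnerSpineStep M M') :
    (∃ l, l < k ∧ ParSize l M' N) ∨ ∃ l N', Spine BetaRule N N' ∧ ParSize l M' N' := by
  induction hM generalizing k N with
  | head hM => exact (h.headSpine hM).imp id fun ⟨l, N', hN, h⟩ => ⟨l, N', .head hN, h⟩
  | lam _ ih =>
    cases h with
    | lam h =>
      obtain ⟨l, hl, h⟩ | ⟨l, N', hN, h⟩ := ih h
      · exact .inl ⟨_, Nat.add_lt_add_right hl 1, h.lam⟩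
      · exact .inr ⟨_, _, .lam hN, h.lam⟩
  | appL Q hneu _ ih =>
    cases h with
    | app h hQ =>
      obtain ⟨l, hl, h'⟩ | ⟨l, N', hN, h'⟩ := ih h
      · exact .inl ⟨_, by omega, h'.app hQ⟩
      · exact .inr ⟨_, _, .appL _ (h.isNeutral hneu) hN, h'.app hQ⟩
    | beta => cases hneu
  | appR P hneu _ ih =>
    cases h with
    | app hP h =>
      obtain ⟨l, hl, h'⟩ | ⟨l, N', hN, h'⟩ := ih h
      · exact .inl ⟨_, by omega, hP.app h'⟩
      · exact .inr ⟨_, _, .appR _ (hP.isNeutral hneu) hN, hP.app h'⟩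
    | beta => cases hneu

theorem eq_of_isNormal {k : ℕ} {M N : Term} (h : ParSize k M N) (hM : IsNormal BetaStep M) :
    N = M := by
  induction h with
  | var i => rfl
  | lam _ ih => rw [ih fun N hN => hM _ (.lam hN)]
  | app _ _ ihM ihN =>
    rw [ihM fun N hN => hM _ (.appL _ hN), ihN fun N hN => hM _ (.appR _ hN)]
  | beta _ _ _ _ => exact absurd (.root (.beta _ _)) (hM _)

/-- The induction is lexicographic: on spine reduction of the target, then on the size. -/
theorem acc_innerSpineStep {k : ℕ} {M N : Term} (h : ParSize k M N)
    (hN : Acc (flip (Spine BetaRule)) N) : Acc (flip InnerSpineStep) M := by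
  induction hN generalizing k M with
  | intro N _ ih =>
    induction k using Nat.strong_induction_on generalizing M with
    | _ k ihk =>
      refine ⟨_, fun M' hM => ?_⟩
      obtain ⟨l, hl, h'⟩ | ⟨l, N', hN, h'⟩ := h.innerSpineStep hM
      · exact ihk l hl h'
      · exact ih N' hN h'

theorem innerSpineStep_reflTransGen {k : ℕ} {M M' N : Term} (h : ParSize k M N)
    (hM : Relation.ReflTransGen InnerSpineStep M M') :
    ∃ l N', Relation.ReflTransGen (Spine BetaRule) N N' ∧ ParSize l M' N' := by
  induction hM with
  | refl => exact ⟨k, N, .refl, h⟩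
  | tail _ hM ih =>
    obtain ⟨m, N₁, hN₁, h₁⟩ := ih
    obtain ⟨l, _, h₂⟩ | ⟨l, N₂, hN₂, h₂⟩ := h₁.innerSpineStep hM
    · exact ⟨l, N₁, hN₁, h₂⟩
    · exact ⟨l, N₂, hN₁.tail hN₂, h₂⟩

end ParSize

/-! ### Inner spine reduction is normalizing -/

theorem acc_innerSpineStep {M : Term} (h : Acc (flip (Spine BetaRule)) M) :
    Acc (flip InnerSpineStep) M :=
  (ParSize.exists_refl M).elim fun _ hk => hk.acc_innerSpineStep h

theorem eq_of_innerSpineStep_reflTransGen {M N L : Term}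
    (h : Relation.ReflTransGen BetaStep M L) (hL : IsNormal BetaStep L)
    (hM : Relation.ReflTransGen InnerSpineStep M N) (hN : IsNormal InnerSpineStep N) : N = L := by
  have hN' : IsNormal BetaStep N :=
    isNormal_compatible_of_innerSpineStep (fun _ _ => BetaRule.exists_redex) hN
  obtain ⟨k, hk⟩ := ParSize.exists_refl M
  obtain ⟨l, N', hMN, hl⟩ := hk.innerSpineStep_reflTransGen hM
  obtain rfl := hl.eq_of_isNormal hN'
  exact eq_of_spine_reflTransGen h hL hMN hN'

theorem exists_reflTransGen_isNormal {r : Term → Term → Prop} {M : Term} (h : Acc (flip r) M) :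
    ∃ N, Relation.ReflTransGen r M N ∧ IsNormal r N := by
  induction h with
  | intro M _ ih =>
    by_cases hM : IsNormal r M
    · exact ⟨M, .refl, hM⟩
    · obtain ⟨M', hM'⟩ := not_forall_not.mp hM
      obtain ⟨N, hN, hN'⟩ := ih M' hM'
      exact ⟨N, .head hM' hN, hN'⟩

theorem not_exists_seq_of_acc {r : Term → Term → Prop} {M : Term} (h : Acc (flip r) M) :
    ¬ ∃ f : ℕ → Term, f 0 = M ∧ ∀ i, r (f i) (f (i + 1)) := by
  induction h with
  | intro M _ ih =>
    rintro ⟨f, rfl, hf⟩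
    exact ih (f 1) (hf 0) ⟨fun i => f (i + 1), rfl, fun i => hf (i + 1)⟩

theorem isNormalizing_innerSpineStep : IsNormalizing InnerSpineStep := by
  intro M L h hL
  have hM := acc_innerSpineStep (acc_spine_of_reflTransGen h hL)
  refine ⟨not_exists_seq_of_acc hM, fun N => eq_of_innerSpineStep_reflTransGen h hL, ?_⟩
  obtain ⟨N, hMN, hN⟩ := exists_reflTransGen_isNormal hM
  exact eq_of_innerSpineStep_reflTransGen h hL hMN hN ▸ hMN

end LambdaCalc

theorem mainTheorem1 :
    LambdaCalc.IsStrategyFor LambdaCalc.InnerSpineStep LambdaCalc.DistStep ∧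
      LambdaCalc.IsNormalizing LambdaCalc.InnerSpineStep :=
  ⟨LambdaCalc.isStrategyFor_innerSpineStep, LambdaCalc.isNormalizing_innerSpineStep⟩
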